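/- Conventions. A manifold is a topological manifold without boundary (Hausdorff, second countable, locally Euclidean). A map $f\colon X\to Y$ is a branched covering if it is continuous, open and discrete (each fibre is a discrete subspace); it is proper if preimages of compact sets are compact. The branch set $B_f\subset X$ is the set of points at which $f$ is not a local homeomorphism; put $Y'_f=Y\setminus f(B_f)$ and $X'_f=f^{-1}(Y'_f)$. A proper branched covering $f$ is completed (in the sense of Fox) if $X'_f\subset X$ and $Y'_f\subset Y$ are dense and their complements do not locally separate $X$ and $Y$, respectively, where $Z\subset X$ does not locally separate $X$ if $U\setminus Z$ is connected for every connected open $U\subset X$. A branched covering $f$ is normal if $f|\colon X'_f\to Y'_f$ is a normal covering map, i.e. a surjective covering map with connected total space whose deck transformations act transitively on each fibre. Connected sets are nonempty. A domain is an open connected subset. A strong domain covering $\{A,B\}$ of a domain $V$ consists of domains $A,B$ with $V=A\cup B$ and $A\cap B$ connected. Let $f\colon X\to Y$ be a branched covering between manifolds and $y\in Y$. A domain $V_0\subset Y$ containing $y$ is a destructive neighbourhood of $y$ if $f|\colon f^{-1}(V_0)\to f(f^{-1}(V_0))$ is not a normal branched covering, but for every neighbourhood $U\subset V_0$ of $y$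 there is a strong domain covering $\{A,B\}$ of $V_0$ such that $y\in A\subset U$ or $y\in B\subset U$, such that $\{f^{-1}(A),f^{-1}(B)\}$ is a strong domain covering of $f^{-1}(V_0)$, and such that the restriction of $f$ to $f^{-1}(A)\cap f^{-1}(B)$ is a normal branched covering onto its image. The point $y$ is a destructive point of $f$ if it has a neighbourhood basis consisting of destructive neighbourhoods. Theorem. Let $f\colon X\to Y$ be a proper branched covering between manifolds, let $X_f$ be a connected, locally connected Hausdorff space, and let $p\colon X_f\to X$ and $\bar f\colon X_f\to Y$ be proper normal branched coverings, both completed in the sense of Fox, with $\bar f=f\circ p$. Suppose that $y\in Y$ is a destructive point of $f$. Then the first singular homology group satisfies $H_1(W;\mathbb{Z})\neq 0$ for every open set $W\subset X_f$ with $\bar f^{-1}\{y\}\cap W\neq\emptyset$. -/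

import Mathlib

open Set Topology

universe u v w

/-- `f` is a branched covering: it is open, continuous and discrete. -/
structure IsBranchedCovering {X : Type u} {Y : Type v} [TopologicalSpace X] [TopologicalSpace Y]
    (f : X → Y) : Prop where
  continuous : Continuous f
  isOpenMap : IsOpenMap f
  discrete : ∀ y : Y, IsDiscrete (f ⁻¹' {y})

/-- Properness of a map: preimages of compact sets are compact. -/
def HasCompactPreimages {X : Type u} {Y : Type v} [TopologicalSpace X] [TopologicalSpace Y]
    (f : X → Y) : Prop :=
  ∀ K : Set Y, IsCompact K → IsCompact (f ⁻¹' K)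

/-- The branch set `B_f`: the points at which `f` fails to be a local homeomorphism. -/
def branchSet {X : Type u} {Y : Type v} [TopologicalSpace X] [TopologicalSpace Y]
    (f : X → Y) : Set X :=
  {x | ¬ IsLocalHomeomorphOn f {x}}

/-- The set `Y' = Y \ f(B_f)`. -/
def regularValues {X : Type u} {Y : Type v} [TopologicalSpace X] [TopologicalSpace Y]
    (f : X → Y) : Set Y :=
  (f '' branchSet f)ᶜ

/-- `Z` does not locally separate `X`: removing `Z` disconnects no connected open subset of `X`. -/
def NotLocallySeparating {X : Type u} [TopologicalSpace X] (Z : Set X) : Prop :=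
  ∀ U : Set X, IsOpen U → IsConnected U → IsConnected (U \ Z)

/-- Proper branched coverings in the sense of Fox (completed coverings): proper branched coverings
for which `Y' = Y \ f(B_f)` and `X' = f⁻¹(Y')` are dense and their complements do not locally
separate `Y` and `X`. -/
structure IsProperCompletedCovering {X : Type u} {Y : Type v} [TopologicalSpace X]
    [TopologicalSpace Y] (f : X → Y) : Prop where
  isBranchedCovering : IsBranchedCovering f
  proper : HasCompactPreimages f
  dense_target : Dense (regularValues f)
  dense_source : Dense (f ⁻¹' regularValues f)
  target_notLocallySeparating : NotLocallySeparating (regularValues f)ᶜ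
  source_notLocallySeparating : NotLocallySeparating (f ⁻¹' regularValues f)ᶜ

/-- A normal covering map: a surjective covering map with connected total space whose deck
transformations act transitively on each fibre. -/
structure IsNormalCovering {S : Type u} {T : Type v} [TopologicalSpace S] [TopologicalSpace T]
    (g : S → T) : Prop where
  isCoveringMap : IsCoveringMap g
  surjective : Function.Surjective g
  connectedSpace : ConnectedSpace S
  exists_deck : ∀ a b : S, g a = g b → ∃ τ : S ≃ₜ S, (∀ s, g (τ s) = g s) ∧ τ a = b

/-- Normality of a branched covering `f : X → Y`: the restriction
`f' : X \ f⁻¹(f(B_f)) → Y \ f(B_f)` is a normal covering map. -/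
def IsNormalBranched {X : Type u} {Y : Type v} [TopologicalSpace X] [TopologicalSpace Y]
    (f : X → Y) : Prop :=
  IsNormalCovering ((regularValues f).restrictPreimage f)

/-- `f|D : D → f(D)` is a normal branched covering onto its image. -/
def IsNormalBranchedOn {X : Type u} {Y : Type v} [TopologicalSpace X] [TopologicalSpace Y]
    (f : X → Y) (D : Set X) : Prop :=
  IsNormalBranched (imageFactorization f D)

/-- A domain: an open connected (in particular nonempty) subset. -/
def IsDomainSet {X : Type u} [TopologicalSpace X] (V : Set X) : Prop :=
  IsOpen V ∧ IsConnected V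

/-- `{A, B}` is a strong domain covering of the domain `V`. -/
structure IsStrongDomainCovering {X : Type u} [TopologicalSpace X] (V A B : Set X) : Prop where
  domain : IsDomainSet V
  left : IsDomainSet A
  right : IsDomainSet B
  eq_union : V = A ∪ B
  strong : IsConnected (A ∩ B)

/-- `{A, B}` is `U`-small at `x`. -/
def IsSmallAt {X : Type u} (U : Set X) (x : X) (A B : Set X) : Prop :=
  (x ∈ A ∧ A ⊆ U) ∨ (x ∈ B ∧ B ⊆ U)

/-- `V` is a destructive neighbourhood of `y` with respect to `f`. -/
structure IsDestructiveNhd {X : Type u} {Y : Type v} [TopologicalSpace X] [TopologicalSpace Y]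
    (f : X → Y) (y : Y) (V : Set Y) : Prop where
  domain : IsDomainSet V
  mem : y ∈ V
  not_normal : ¬ IsNormalBranchedOn f (f ⁻¹' V)
  exists_covering : ∀ U ∈ 𝓝 y, U ⊆ V → ∃ A B : Set Y,
    IsStrongDomainCovering V A B ∧ IsSmallAt U y A B ∧
    IsStrongDomainCovering (f ⁻¹' V) (f ⁻¹' A) (f ⁻¹' B) ∧
    IsNormalBranchedOn f (f ⁻¹' A ∩ f ⁻¹' B)

/-- `y` is a destructive point of `f`: it has a neighbourhood basis of destructive
neighbourhoods. -/
def IsDestructivePoint {X : Type u} {Y : Type v} [TopologicalSpace X] [TopologicalSpace Y]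
    (f : X → Y) (y : Y) : Prop :=
  ∀ U ∈ 𝓝 y, ∃ V : Set Y, V ⊆ U ∧ IsDestructiveNhd f y V

/-- The first singular homology group `H₁(W; ℤ)`. The coefficients are lifted to the universe
of `W`. -/
noncomputable def singularH1 (W : Type u) [TopologicalSpace W] : ModuleCat.{u} ℤ :=
  ((AlgebraicTopology.singularHomologyFunctor (ModuleCat.{u} ℤ) 1).obj
    (ModuleCat.of ℤ (ULift.{u} ℤ))).obj (TopCat.of W)

/-! ### Detecting `H₁` by real cocycles -/

section SingularHomology

open CategoryTheory Simplicial

/-! Fix a point `x` of `W` over `y` and a destructive neighbourhood `V` so small that the component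
`D` of `x` over `V` lies in `W`. Write `V = S ∪ L` as a strong domain covering with `S` tiny around
`y` and `f` normal over `S ∩ L`, and let `T ⊆ D` be the component of `x` over `S`. Smallness of `S`
makes the part of `D` over `L` connected
(`IsProperCompletedCovering.exists_nhds_isConnected_inter`). Everything depends on the part of `T`
over `S ∩ L`.

If it is disconnected, a Mayer–Vietoris argument yields a class: two points in different components
are joined inside `T` and also inside `D` over `L`, and the resulting loop in `W` winds once around
the circle under a suitable map (`nontrivial_singularH1_of_joinedIn`).

If it is connected, deck transformations of `fbar` preserving `T` descend to `f` over `S`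
(`exists_isDeckPair_of_subset`): normality of `f` over `S ∩ L` gives the descent there, and
uniqueness of lifts spreads it over `T`. These transformations extend across regular values of `f`
that are not regular for `fbar` (`IsDeckPair.extend`), so `f` is normal over every destructive
neighbourhood contained in `S` (`isNormalBranchedOn_of_isDeckPair`), a contradiction. -/

theorem toSSetObjEquiv_delta {W : TopCat.{u}} {n : ℕ} (i : Fin (n + 2))
    (x : (TopCat.toSSet.obj W) _⦋n + 1⦌) (t : stdSimplex ℝ (Fin (n + 1))) :
    TopCat.toSSetObjEquiv W _ ((TopCat.toSSet.obj W).δ i x) t =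
      TopCat.toSSetObjEquiv W _ x (stdSimplex.map i.succAbove t) := rfl

/-- The homomorphisms `ℤ → ℝ` of abelian groups, lifted to a given universe. -/
noncomputable def intToRealHom :
    ℝ →+ (ModuleCat.of ℤ (ULift.{u} ℤ) ⟶ ModuleCat.of ℤ (ULift.{u} ℝ)) where
  toFun x := ModuleCat.ofHom
    ((LinearMap.toSpanSingleton ℤ _ (ULift.up x)).comp ULift.moduleEquiv.toLinearMap)
  map_zero' := by ext; simp
  map_add' x y := by ext; simp [mul_add]

theorem intToRealHom_injective : Function.Injective intToRealHom.{u} := by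
  intro x y h
  have := congr(($h).hom (ULift.up 1))
  simpa [intToRealHom] using this

/-- A real singular cocycle that does not vanish on a two-simplex cycle detects `H₁`. -/
theorem nontrivial_singularH1_of_cocycle {W : Type u} [TopologicalSpace W]
    (c : C(stdSimplex ℝ (Fin 2), W) → ℝ)
    (hc : ∀ τ : C(stdSimplex ℝ (Fin 3), W),
      ∑ i : Fin 3, (-1 : ℤ) ^ (i : ℕ) • c (τ.comp ⟨_, stdSimplex.continuous_map i.succAbove⟩) = 0)
    (σ₀ σ₁ : C(stdSimplex ℝ (Fin 2), W))
    (h₀ : σ₀ (stdSimplex.vertex 1) = σ₁ (stdSimplex.vertex 0))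
    (h₁ : σ₁ (stdSimplex.vertex 1) = σ₀ (stdSimplex.vertex 0))
    (hne : c σ₀ + c σ₁ ≠ 0) : Nontrivial (singularH1 W) := by
  by_contra hcon
  rw [not_nontrivial_iff_subsingleton] at hcon
  let S := TopCat.toSSet.obj (TopCat.of W)
  let R : ModuleCat.{u} ℤ := ModuleCat.of ℤ (ULift.{u} ℤ)
  let K := S.chainComplex R
  have hK : Limits.IsZero (K.homology 1) := ModuleCat.isZero_of_subsingleton (singularH1 W)
  let T : ModuleCat.{u} ℤ := ModuleCat.of ℤ (ULift.{u} ℝ)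
  let e := TopCat.toSSetObjEquiv (TopCat.of W) (.op ⦋1⦌)
  let φ : K.X 1 ⟶ T := Limits.Sigma.desc fun σ => intToRealHom (c (e σ))
  have hφ (x : S _⦋1⦌) : S.ιChainComplex x ≫ φ = intToRealHom (c (e x)) :=
    Limits.Sigma.ι_desc _ _
  have hdφ : K.d 2 1 ≫ φ = 0 := by
    apply SSet.chainComplex_hom_ext
    intro x
    rw [SSet.ιChainComplex_d_assoc, Preadditive.sum_comp, Limits.comp_zero,
      ← map_zero intToRealHom.{u}, ← hc (TopCat.toSSetObjEquiv (TopCat.of W) (.op ⦋2⦌) x),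
      map_sum]
    refine Finset.sum_congr rfl fun i _ => ?_
    rw [Preadditive.zsmul_comp, hφ, map_zsmul]
    rfl
  let z : R ⟶ K.X 1 := S.ιChainComplex (e.symm σ₀) + S.ιChainComplex (e.symm σ₁)
  have hzφ : z ≫ φ = intToRealHom (c σ₀ + c σ₁) := by
    simp only [z, Preadditive.add_comp, hφ, Equiv.apply_symm_apply, map_add]
  -- In `Fin 2` adding one swaps the two indices, so the face omitting `i + 1` is the vertex `i`.
  have hδ (σ σ' : C(stdSimplex ℝ (Fin 2), W)) (i j : Fin 2)
      (h : σ (stdSimplex.vertex i) = σ' (stdSimplex.vertex j)) :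
      S.δ (i + 1) (e.symm σ) = S.δ (j + 1) (e.symm σ') := by
    apply (TopCat.toSSetObjEquiv (TopCat.of W) (.op ⦋0⦌)).injective
    ext t
    rw [Subsingleton.elim t (stdSimplex.vertex (0 : Fin 1))]
    rw [toSSetObjEquiv_delta, toSSetObjEquiv_delta]
    change e (e.symm σ) _ = e (e.symm σ') _
    rw [Equiv.apply_symm_apply, Equiv.apply_symm_apply, stdSimplex.map_vertex,
      stdSimplex.map_vertex]
    convert h using 3 <;> [fin_cases i; fin_cases j] <;> rfl
  have hzd : z ≫ K.d 1 0 = 0 := by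
    have hι (x : S _⦋1⦌) : S.ιChainComplex x ≫ K.d 1 0 =
        (S.ιChainComplex (S.δ 0 x) - S.ιChainComplex (S.δ 1 x) : R ⟶ K.X 0) := by
      refine (SSet.ιChainComplex_d S R x).trans ((Fin.sum_univ_two _).trans ?_)
      simp [sub_eq_add_neg]
    have a₁ : S.δ 0 (e.symm σ₀) = S.δ 1 (e.symm σ₁) := hδ _ _ 1 0 h₀
    have a₂ : S.δ 0 (e.symm σ₁) = S.δ 1 (e.symm σ₀) := hδ _ _ 1 0 h₁
    simp only [z, Preadditive.add_comp, hι, a₁, a₂]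
    simp
  have hex : K.ExactAt 1 := (HomologicalComplex.exactAt_iff_isZero_homology _ _).2 hK
  rw [K.exactAt_iff' 2 1 0 (by simp) (by simp)] at hex
  have h0 : z ≫ φ = 0 := by
    have : (K.sc' 2 1 0).Exact := hex
    rw [ShortComplex.moduleCat_exact_iff] at this
    refine ModuleCat.hom_ext (LinearMap.ext fun x => ?_)
    obtain ⟨w, hw⟩ := this (z.hom x) congr(($hzd).hom x)
    have := congr(($hdφ).hom w)
    change φ.hom (z.hom x) = 0
    rw [← hw]
    exact this
  rw [hzφ] at h0
  exact hne (intToRealHom_injective (h0.trans (map_zero _).symm))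

end SingularHomology

/-! ### Winding numbers of circle-valued maps -/

section Winding

open unitInterval

/-- A lift of a circle-valued map on a simplex to the real line. -/
theorem exists_lift_stdSimplex {n : ℕ} (g : C(stdSimplex ℝ (Fin (n + 1)), AddCircle (1 : ℝ))) :
    ∃ l : C(stdSimplex ℝ (Fin (n + 1)), ℝ), ∀ t, (l t : AddCircle (1 : ℝ)) = g t := by
  have cov := AddCircle.isCoveringMap_coe (1 : ℝ)
  let v : stdSimplex ℝ (Fin (n + 1)) := stdSimplex.vertex 0
  obtain ⟨r, hr⟩ := QuotientAddGroup.mk_surjective (g v)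
  -- Straight-line contraction of the simplex to `v`: at time 0 the map is constant, with lift `r`,
  -- and at time 1 it is `g`, so homotopy lifting applies.
  let H : C(I × stdSimplex ℝ (Fin (n + 1)), AddCircle (1 : ℝ)) :=
    g.comp ⟨fun q => ⟨fun i => (1 - (q.1 : ℝ)) * v.1 i + q.1 * q.2.1 i,
      convex_stdSimplex ℝ _ v.2 q.2.2 (sub_nonneg.2 q.1.2.2) q.1.2.1 (sub_add_cancel _ _)⟩,
      Continuous.subtype_mk (continuous_pi fun i => by
        have h : Continuous fun q : I × stdSimplex ℝ (Fin (n + 1)) => q.2.1 i :=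
          (continuous_apply i).comp (continuous_subtype_val.comp continuous_snd)
        fun_prop) _⟩
  have hH (a) : H (0, a) =
      ((ContinuousMap.const _ r : C(stdSimplex ℝ (Fin (n + 1)), ℝ)) a : ℝ) := by
    refine Eq.trans ?_ hr.symm
    change g _ = g _
    congr 1
    ext i
    simp
  refine ⟨(cov.liftHomotopy H _ hH).comp ⟨fun t => (1, t), by fun_prop⟩, fun t => ?_⟩
  refine (congrFun (cov.liftHomotopy_lifts H _ hH) (1, t)).trans ?_
  change g _ = g _
  congr 1
  ext i
  simp

/-- Two lifts of one map on a connected space differ by a constant, so increments do not depend on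
the lift. -/
theorem AddCircle.lift_sub_lift_eq {A : Type*} [TopologicalSpace A] [PreconnectedSpace A]
    {l l' : C(A, ℝ)} (h : ∀ t, (l t : AddCircle (1 : ℝ)) = l' t) (s t : A) :
    l t - l s = l' t - l' s := by
  have cov := AddCircle.isCoveringMap_coe (1 : ℝ)
  have := cov.eq_of_comp_eq (g₁ := l) (g₂ := fun t => l' t + (l s - l' s)) (by fun_prop)
    (by fun_prop) (by ext t; simp [h]) s (by ring)
  rw [congrFun this t]
  ring

/-- The total variation of the argument of a circle-valued map along a singular simplex. -/
noncomputable def windingCochain {W : Type u} [TopologicalSpace W] (g : C(W, AddCircle (1 : ℝ)))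
    (s : C(stdSimplex ℝ (Fin 2), W)) : ℝ :=
  (exists_lift_stdSimplex (g.comp s)).choose (stdSimplex.vertex 1) -
    (exists_lift_stdSimplex (g.comp s)).choose (stdSimplex.vertex 0)

theorem windingCochain_eq {W : Type u} [TopologicalSpace W] {g : C(W, AddCircle (1 : ℝ))}
    {s : C(stdSimplex ℝ (Fin 2), W)} (l : C(stdSimplex ℝ (Fin 2), ℝ))
    (h : ∀ t, (l t : AddCircle (1 : ℝ)) = g (s t)) :
    windingCochain g s = l (stdSimplex.vertex 1) - l (stdSimplex.vertex 0) :=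
  AddCircle.lift_sub_lift_eq
    (fun t => ((exists_lift_stdSimplex (g.comp s)).choose_spec t).trans (h t).symm) _ _

theorem nontrivial_singularH1_of_winding {W : Type u} [TopologicalSpace W]
    (g : C(W, AddCircle (1 : ℝ))) {a b : W} (γ₁ : Path a b) (γ₂ : Path b a) (l₁ l₂ : C(I, ℝ))
    (h₁ : ∀ t, (l₁ t : AddCircle (1 : ℝ)) = g (γ₁ t))
    (h₂ : ∀ t, (l₂ t : AddCircle (1 : ℝ)) = g (γ₂ t))
    (hne : l₁ 1 - l₁ 0 + (l₂ 1 - l₂ 0) ≠ 0) : Nontrivial (singularH1 W) := by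
  let e : C(stdSimplex ℝ (Fin 2), I) := ⟨_, stdSimplexHomeomorphUnitInterval.continuous⟩
  have e0 : e (stdSimplex.vertex 0) = 0 := stdSimplexHomeomorphUnitInterval_zero
  have e1 : e (stdSimplex.vertex 1) = 1 := stdSimplexHomeomorphUnitInterval_one
  refine nontrivial_singularH1_of_cocycle (windingCochain g) (fun τ => ?_)
    (γ₁.toContinuousMap.comp e) (γ₂.toContinuousMap.comp e) (by simp [e0, e1]) (by simp [e0, e1]) ?_
  -- A single lift over the 2-simplex computes all three edges, and the alternating sum telescopes.
  · obtain ⟨l, hl⟩ := exists_lift_stdSimplex (g.comp τ)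
    have key (i : Fin 3) := windingCochain_eq (g := g)
      (s := τ.comp ⟨_, stdSimplex.continuous_map i.succAbove⟩)
      (l.comp ⟨_, stdSimplex.continuous_map i.succAbove⟩) (fun t => hl _)
    simp only [Fin.sum_univ_three, key, ContinuousMap.comp_apply, ContinuousMap.coe_mk,
      stdSimplex.map_vertex]
    have : (Fin.succAbove (0 : Fin 3) 1 = 2) ∧ (Fin.succAbove (0 : Fin 3) 0 = 1) ∧
      (Fin.succAbove (1 : Fin 3) 1 = 2) ∧ (Fin.succAbove (1 : Fin 3) 0 = 0) ∧
      (Fin.succAbove (2 : Fin 3) 1 = 1) ∧ (Fin.succAbove (2 : Fin 3) 0 = 0) := by decide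
    simp [this]
  · rw [windingCochain_eq (l₁.comp e) (fun t => h₁ _),
      windingCochain_eq (l₂.comp e) (fun t => h₂ _)]
    simpa [e0, e1] using hne

end Winding

/-! ### Components of preimages -/

section Components

variable {X : Type*} {Y : Type*} [TopologicalSpace X] [TopologicalSpace Y]

theorem closure_connectedComponentIn_inter_subset (F : Set X) (x : X) :
    closure (connectedComponentIn F x) ∩ F ⊆ connectedComponentIn F x := by
  rintro z ⟨hz, hzF⟩
  by_cases hx : x ∈ F
  · have hC : IsPreconnected (insert z (connectedComponentIn F x)) :=
      isPreconnected_connectedComponentIn.subset_closure (subset_insert _ _)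
        (insert_subset hz subset_closure)
    exact hC.subset_connectedComponentIn (mem_insert_of_mem _ (mem_connectedComponentIn hx))
      (insert_subset hzF (connectedComponentIn_subset F x)) (mem_insert _ _)
  · simp [connectedComponentIn_eq_empty hx] at hz

/-- The image of a component is open because `q` is open and relatively closed in `O` because `q` is
closed; connectedness of `O` does the rest. -/
theorem image_connectedComponentIn_preimage [LocallyConnectedSpace X] {q : X → Y}
    (hq : Continuous q) (hopen : IsOpenMap q) (hclosed : IsClosedMap q) {O : Set Y}
    (hO : IsOpen O) (hOc : IsPreconnected O) {x : X} (hx : q x ∈ O) :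
    q '' connectedComponentIn (q ⁻¹' O) x = O := by
  have hCO : q '' connectedComponentIn (q ⁻¹' O) x ⊆ O :=
    image_subset_iff.2 (connectedComponentIn_subset _ _)
  refine hCO.antisymm (hOc.subset_of_closure_inter_subset
    (hopen _ (hO.preimage hq).connectedComponentIn)
    ⟨q x, hx, mem_image_of_mem q (mem_connectedComponentIn hx)⟩ ?_)
  rintro o ⟨ho, hoO⟩
  obtain ⟨z, hz, rfl⟩ := hclosed.closure_image_subset _ ho
  exact mem_image_of_mem q (closure_connectedComponentIn_inter_subset _ _ ⟨hz, hoO⟩)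

theorem notMem_of_mem_frontier_connectedComponentIn [LocallyConnectedSpace X] {F : Set X}
    (hF : IsOpen F) {x z : X} (hz : z ∈ frontier (connectedComponentIn F x)) : z ∉ F := by
  intro hzF
  rw [hF.connectedComponentIn.frontier_eq] at hz
  exact hz.2 (closure_connectedComponentIn_inter_subset _ _ ⟨hz.1, hzF⟩)

end Components

/-! ### The Mayer–Vietoris loop -/

open unitInterval in
/-- If a component over `S ∩ L` is separated from `b`, while `a` and `b` can be joined both over `S`
and over `L`, then the resulting loop has winding number one for a map to the circle. -/
theorem nontrivial_singularH1_of_joinedIn {X : Type u} {Y : Type v} [TopologicalSpace X]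
    [TopologicalSpace Y] [LocallyConnectedSpace X] {q : X → Y} (hq : Continuous q) {S L : Set Y}
    (hS : IsOpen S) (hL : IsOpen L) (φ : C(Y, ℝ)) (hφ₀ : ∀ y ∉ S, φ y = 0)
    (hφ₁ : ∀ y ∈ S, y ∉ L → φ y = 1) {W : Set X} {a b : X}
    (hb : b ∉ connectedComponentIn (q ⁻¹' (S ∩ L)) a)
    (hab : JoinedIn (W ∩ q ⁻¹' S) a b) (hba : JoinedIn (W ∩ q ⁻¹' L) b a) :
    Nontrivial (singularH1 W) := by
  classical
  let P := connectedComponentIn (q ⁻¹' (S ∩ L)) a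
  have haP : a ∈ P := mem_connectedComponentIn ⟨hab.source_mem.2, hba.target_mem.2⟩
  have hfr {z : X} (hz : z ∈ frontier P) : q z ∉ S ∩ L :=
    notMem_of_mem_frontier_connectedComponentIn ((hS.inter hL).preimage hq) hz
  have hcont : Continuous fun x => (φ (q x) : ℝ) := φ.continuous.comp hq
  -- On the frontier of `P` the value of `φ ∘ q` is 0 or 1, hence zero in the circle, so gluing with
  -- 0 outside `P` is continuous.
  let g : C(X, AddCircle (1 : ℝ)) := ⟨fun x => if x ∈ P then ((φ (q x) : ℝ) : AddCircle (1 : ℝ))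
    else 0, by
      refine Continuous.if (fun z hz => ?_) ((AddCircle.continuous_mk' 1).comp hcont)
        continuous_const
      by_cases hzS : q z ∈ S
      · rw [hφ₁ _ hzS fun hzL => hfr hz ⟨hzS, hzL⟩, AddCircle.coe_period]
      · rw [hφ₀ _ hzS, QuotientAddGroup.mk_zero]⟩
  -- Real lifts of `g`: over `S` the frontier value is 1, over `L` it is 0. The increments are `1 -
  -- φ (q a)` from `a` to `b` and `φ (q a)` on the way back, with total 1.
  have hl₁ : ContinuousOn (fun x => if x ∈ P then φ (q x) - 1 else 0) (q ⁻¹' S) := by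
    refine ContinuousOn.if (fun z hz => ?_) (hcont.sub continuous_const).continuousOn
      continuousOn_const
    rw [hφ₁ _ hz.1 fun hzL => hfr hz.2 ⟨hz.1, hzL⟩, sub_self]
  have hl₂ : ContinuousOn (fun x => if x ∈ P then φ (q x) else 0) (q ⁻¹' L) := by
    refine ContinuousOn.if (fun z hz => ?_) hcont.continuousOn continuousOn_const
    exact hφ₀ _ fun hzS => hfr hz.2 ⟨hzS, hz.1⟩
  let γ₁ : Path (⟨a, hab.source_mem.1⟩ : W) ⟨b, hab.target_mem.1⟩ :=
    { toFun t := ⟨hab.somePath t, (hab.somePath_mem t).1⟩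
      continuous_toFun := Continuous.subtype_mk hab.somePath.continuous _
      source' := by simp
      target' := by simp }
  let γ₂ : Path (⟨b, hab.target_mem.1⟩ : W) ⟨a, hab.source_mem.1⟩ :=
    { toFun t := ⟨hba.somePath t, (hba.somePath_mem t).1⟩
      continuous_toFun := Continuous.subtype_mk hba.somePath.continuous _
      source' := by simp
      target' := by simp }
  refine nontrivial_singularH1_of_winding (g.comp ⟨_, continuous_subtype_val⟩) γ₁ γ₂
    ⟨_, hl₁.comp_continuous hab.somePath.continuous fun t => (hab.somePath_mem t).2⟩
    ⟨_, hl₂.comp_continuous hba.somePath.continuous fun t => (hba.somePath_mem t).2⟩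
    (fun t => ?_) (fun t => ?_) ?_
  · by_cases h : hab.somePath t ∈ P <;> simp [g, γ₁, h]
  · by_cases h : hba.somePath t ∈ P <;> simp [g, γ₂, h]
  · have hb' : b ∉ P := hb
    simp [haP, hb']

/-! ### Regular values, deck transformations and composition -/

section Basic

variable {X : Type u} {Y : Type v} [TopologicalSpace X] [TopologicalSpace Y] {f : X → Y}

theorem isLocalHomeomorphOn_singleton_iff (hf : Continuous f) (ho : IsOpenMap f) {x : X} :
    IsLocalHomeomorphOn f {x} ↔ ∃ U, IsOpen U ∧ x ∈ U ∧ InjOn f U := by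
  rw [isLocalHomeomorphOn_iff_isOpenEmbedding_restrict]
  constructor
  · intro h
    obtain ⟨U, hU, he⟩ := h x rfl
    exact ⟨interior U, isOpen_interior, mem_interior_iff_mem_nhds.2 hU,
      (injOn_iff_injective.2 he.injective).mono interior_subset⟩
  · rintro ⟨U, hU, hxU, hinj⟩ _ rfl
    exact ⟨U, hU.mem_nhds hxU, .of_continuous_injective_isOpenMap
      (hf.comp continuous_subtype_val) (injOn_iff_injective.1 hinj)
      (ho.comp hU.isOpenMap_subtype_val)⟩

theorem mem_regularValues {y : Y} :
    y ∈ regularValues f ↔ ∀ x, f x = y → IsLocalHomeomorphOn f {x} := by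
  simp only [regularValues, branchSet, mem_compl_iff, mem_image, mem_ofPred_eq, not_exists, not_and]
  exact forall_congr' fun x => ⟨fun h e => by_contra fun h' => h h' e, fun h h' e => h' (h e)⟩

theorem isLocalHomeomorphOn_preimage_regularValues :
    IsLocalHomeomorphOn f (f ⁻¹' regularValues f) :=
  fun x hx => mem_regularValues.1 hx x rfl x rfl

theorem isOpen_regularValues (hc : IsClosedMap f) : IsOpen (regularValues f) := by
  refine (hc _ ?_).isOpen_compl
  rw [← isOpen_compl_iff, isOpen_iff_mem_nhds]
  intro x hx
  obtain ⟨e, hxe, he⟩ := not_not.1 hx x rfl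
  filter_upwards [e.open_source.mem_nhds hxe] with z hz
  exact not_not.2 fun _ h => ⟨e, h ▸ hz, he⟩

theorem HasCompactPreimages.isClosedMap [T2Space Y] [WeaklyLocallyCompactSpace Y]
    (h : HasCompactPreimages f) (hf : Continuous f) : IsClosedMap f :=
  (isProperMap_iff_isCompact_preimage.2 ⟨hf, fun K hK => h K hK⟩).isClosedMap

theorem HasCompactPreimages.finite_fiber (h : HasCompactPreimages f) (hf : IsBranchedCovering f)
    (y : Y) : (f ⁻¹' {y}).Finite :=
  (h _ isCompact_singleton).finite (hf.discrete y)

theorem IsNormalBranched.surjective (h : IsNormalBranched f) (hd : Dense (regularValues f))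
    (hc : IsClosedMap f) : Function.Surjective f := by
  have hR : regularValues f ⊆ range f := fun y hy => by
    obtain ⟨x, hx⟩ := IsNormalCovering.surjective h ⟨y, hy⟩
    exact ⟨x.1, congrArg Subtype.val hx⟩
  exact range_eq_univ.1 (univ_subset_iff.1
    (hd.closure_eq ▸ hc.isClosed_range.closure_subset_iff.2 hR))

/-- `τ` and `τ'` restrict to mutually inverse homeomorphisms of `Z` over `q`. -/
structure IsDeckPair {S : Type*} {T : Type*} [TopologicalSpace S] (q : S → T) (Z : Set S)
    (τ τ' : S → S) : Prop where
  continuousOn : ContinuousOn τ Z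
  continuousOn_symm : ContinuousOn τ' Z
  mapsTo : MapsTo τ Z Z
  mapsTo_symm : MapsTo τ' Z Z
  map_eq : ∀ x ∈ Z, q (τ x) = q x
  map_symm_eq : ∀ x ∈ Z, q (τ' x) = q x
  leftInv : LeftInvOn τ' τ Z
  rightInv : LeftInvOn τ τ' Z

theorem IsDeckPair.symm {S T : Type*} [TopologicalSpace S] {q : S → T} {Z : Set S} {τ τ' : S → S}
    (h : IsDeckPair q Z τ τ') : IsDeckPair q Z τ' τ :=
  ⟨h.2, h.1, h.4, h.3, h.6, h.5, h.8, h.7⟩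

theorem IsDeckPair.of_homeomorph {S T : Type*} [TopologicalSpace S] {q : S → T} {Z : Set S}
    (τ : Z ≃ₜ Z) (h : ∀ z, q (τ z) = q z) {a : S} (ha : a ∈ Z) :
    ∃ σ σ' : S → S, IsDeckPair q Z σ σ' ∧ σ a = τ ⟨a, ha⟩ := by
  classical
  let ext (ρ : Z ≃ₜ Z) (s : S) : S := if hs : s ∈ Z then ρ ⟨s, hs⟩ else s
  have hext (ρ : Z ≃ₜ Z) (s : S) (hs : s ∈ Z) : ext ρ s = ρ ⟨s, hs⟩ := dif_pos hs
  have hmaps (ρ : Z ≃ₜ Z) : MapsTo (ext ρ) Z Z := fun s hs => by rw [hext _ _ hs]; exact (ρ _).2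
  have hcont (ρ : Z ≃ₜ Z) : ContinuousOn (ext ρ) Z := by
    rw [continuousOn_iff_continuous_domRestrict]
    convert continuous_subtype_val.comp ρ.continuous using 1
    ext s
    exact hext _ _ s.2
  refine ⟨ext τ, ext τ.symm, ⟨hcont _, hcont _, hmaps _, hmaps _, fun s hs => ?_, fun s hs => ?_,
    fun s hs => ?_, fun s hs => ?_⟩, hext _ _ ha⟩
  · rw [hext _ _ hs, h]
  · rw [hext _ _ hs, ← h, Homeomorph.apply_symm_apply]
  · simp [hext _ _ hs, hext τ.symm _ (τ ⟨s, hs⟩).2]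
  · simp [hext _ _ hs, hext τ _ (τ.symm ⟨s, hs⟩).2]

theorem IsNormalBranched.exists_isDeckPair (h : IsNormalBranched f) {a b : X}
    (ha : f a ∈ regularValues f) (hab : f a = f b) :
    ∃ τ τ' : X → X, IsDeckPair f (f ⁻¹' regularValues f) τ τ' ∧ τ a = b := by
  obtain ⟨ρ, hρ, hρa⟩ := h.exists_deck ⟨a, ha⟩ ⟨b, (hab ▸ ha : f b ∈ _)⟩ (Subtype.ext hab)
  obtain ⟨τ, τ', hτ, hτa⟩ := IsDeckPair.of_homeomorph (q := f) ρ
    (fun z => congrArg Subtype.val (hρ z)) ha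
  exact ⟨τ, τ', hτ, hτa.trans (congrArg Subtype.val hρa)⟩

section Composition

variable {Z : Type w} [TopologicalSpace Z] {p : Z → X}

theorem IsLocalHomeomorphOn.of_comp_isOpenMap (hf : Continuous f) (hfo : IsOpenMap f)
    (hp : Continuous p) (hpo : IsOpenMap p) {z : Z} (h : IsLocalHomeomorphOn (f ∘ p) {z}) :
    IsLocalHomeomorphOn p {z} ∧ IsLocalHomeomorphOn f {p z} := by
  rw [isLocalHomeomorphOn_singleton_iff (hf.comp hp) (hfo.comp hpo)] at h
  obtain ⟨U, hU, hzU, hinj⟩ := h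
  rw [isLocalHomeomorphOn_singleton_iff hp hpo, isLocalHomeomorphOn_singleton_iff hf hfo]
  refine ⟨⟨U, hU, hzU, fun a ha b hb hab => hinj ha hb (congrArg f hab)⟩,
    p '' U, hpo U hU, mem_image_of_mem p hzU, ?_⟩
  rintro _ ⟨a, ha, rfl⟩ _ ⟨b, hb, rfl⟩ hab
  rw [hinj ha hb hab]

theorem regularValues_comp_subset (hf : Continuous f) (hfo : IsOpenMap f)
    (hp : Continuous p) (hpo : IsOpenMap p) (hs : Function.Surjective p) :
    regularValues (f ∘ p) ⊆ regularValues f := by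
  intro y hy
  rw [mem_regularValues] at hy ⊢
  intro x hx
  obtain ⟨z, rfl⟩ := hs x
  exact (IsLocalHomeomorphOn.of_comp_isOpenMap hf hfo hp hpo (hy z hx)).2

theorem preimage_regularValues_comp_subset (hf : Continuous f) (hfo : IsOpenMap f)
    (hp : Continuous p) (hpo : IsOpenMap p) :
    f ⁻¹' regularValues (f ∘ p) ⊆ regularValues p := by
  intro x hx
  rw [mem_preimage, mem_regularValues] at hx
  refine mem_regularValues.2 fun z hz => ?_
  exact (IsLocalHomeomorphOn.of_comp_isOpenMap hf hfo hp hpo (hx z (congrArg f hz))).1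

end Composition

/-- The set `f ⁻¹' M` is open and contains every fibre over `M` entirely, so the restriction has no
fewer preimages to test. -/
theorem regularValues_imageFactorization (hf : Continuous f) (hfo : IsOpenMap f) {M : Set Y}
    (hM : IsOpen M) :
    regularValues (imageFactorization f (f ⁻¹' M)) = Subtype.val ⁻¹' regularValues f := by
  have hD := hM.preimage hf
  have hc : Continuous (imageFactorization f (f ⁻¹' M)) :=
    Continuous.subtype_mk (hf.comp continuous_subtype_val) _
  have ho : IsOpenMap (imageFactorization f (f ⁻¹' M)) := fun U hU =>
    ⟨f '' (Subtype.val '' U), hfo _ (hD.isOpenMap_subtype_val _ hU), by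
      ext ⟨y, hy⟩
      simp [imageFactorization]⟩
  ext ⟨y, x₀, hx₀, rfl⟩
  simp only [mem_preimage, mem_regularValues]
  constructor
  · intro h x hx
    have hxM : x ∈ f ⁻¹' M := by rw [mem_preimage, hx]; exact hx₀
    obtain ⟨U, hU, hxU, hinj⟩ := (isLocalHomeomorphOn_singleton_iff hc ho).1
      (h ⟨x, hxM⟩ (Subtype.ext hx))
    refine (isLocalHomeomorphOn_singleton_iff hf hfo).2
      ⟨_, hD.isOpenMap_subtype_val _ hU, ⟨_, hxU, rfl⟩, ?_⟩
    rintro _ ⟨a, ha, rfl⟩ _ ⟨b, hb, rfl⟩ hab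
    rw [hinj ha hb (Subtype.ext hab)]
  · intro h x hx
    obtain ⟨U, hU, hxU, hinj⟩ := (isLocalHomeomorphOn_singleton_iff hf hfo).1
      (h x (congrArg Subtype.val hx))
    exact (isLocalHomeomorphOn_singleton_iff hc ho).2 ⟨_, hU.preimage continuous_subtype_val, hxU,
      fun a ha b hb hab => Subtype.ext (hinj ha hb (congrArg Subtype.val hab))⟩

theorem IsNormalBranchedOn.exists_deck (hf : Continuous f) (hfo : IsOpenMap f) {M : Set Y}
    (hM : IsOpen M) (h : IsNormalBranchedOn f (f ⁻¹' M)) {a b : X}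
    (ha : f a ∈ M ∩ regularValues f) (hab : f a = f b) :
    ∃ δ : X → X, ContinuousOn δ (f ⁻¹' (M ∩ regularValues f)) ∧
      (∀ x ∈ f ⁻¹' (M ∩ regularValues f), f (δ x) = f x) ∧ δ a = b := by
  classical
  have hR := regularValues_imageFactorization hf hfo hM
  have hmem {x : X} (hx : x ∈ f ⁻¹' (M ∩ regularValues f)) :
      imageFactorization f (f ⁻¹' M) ⟨x, hx.1⟩ ∈
        regularValues (imageFactorization f (f ⁻¹' M)) := by rw [hR]; exact hx.2
  have hb : b ∈ f ⁻¹' (M ∩ regularValues f) := by rw [mem_preimage, ← hab]; exact ha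
  obtain ⟨ρ, hρ, hρa⟩ := IsNormalCovering.exists_deck h ⟨⟨a, ha.1⟩, hmem ha⟩ ⟨⟨b, hb.1⟩, hmem hb⟩
    (Subtype.ext (Subtype.ext hab))
  let δ (x : X) : X := if hx : x ∈ f ⁻¹' (M ∩ regularValues f) then
    (ρ ⟨⟨x, hx.1⟩, hmem hx⟩).1.1 else x
  have hδ {x : X} (hx : x ∈ f ⁻¹' (M ∩ regularValues f)) : δ x = (ρ ⟨⟨x, hx.1⟩, hmem hx⟩).1.1 :=
    dif_pos hx
  refine ⟨δ, ?_, fun x hx => ?_, ?_⟩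
  · rw [continuousOn_iff_continuous_domRestrict]
    have : (f ⁻¹' (M ∩ regularValues f)).domRestrict δ =
        fun x => (ρ ⟨⟨x.1, x.2.1⟩, hmem x.2⟩).1.1 := funext fun x => hδ x.2
    rw [this]
    fun_prop
  · rw [hδ hx]
    exact congrArg (fun t => t.1.1) (hρ ⟨⟨x, hx.1⟩, hmem hx⟩)
  · rw [hδ ha, hρa]

end Basic

/-! ### Boundary values of deck transformations -/

section Extension

open Filter

variable {X : Type u} {Y : Type v} [TopologicalSpace X] [TopologicalSpace Y] {f : X → Y}

/-- Lifts of `f` along itself near `a` converge at `a` to the point in the sheet of their value at a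
nearby point of the sheet of `a`; here `β` matches the fibre of `a` with a nearby fibre. -/
theorem exists_sheet_comparison [LocallyConnectedSpace Y] {R R₀ V : Set Y}
    (hcov : IsCoveringMapOn f R) (hR : IsOpen R) (hsep : NotLocallySeparating R₀ᶜ)
    (hV : IsOpen V) {a : X} (ha : f a ∈ V ∩ R) :
    ∃ s ∈ V ∩ R₀, ∃ β : X → X, (∀ b, f b = f a → f (β b) = s) ∧
      (∀ c, f c = s → ∃ b, f b = f a ∧ β b = c) ∧
      ∀ τ : X → X, ContinuousOn τ (f ⁻¹' (V ∩ R₀)) → (∀ x ∈ f ⁻¹' (V ∩ R₀), f (τ x) = f x) →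
        ∀ b, f b = f a → τ (β a) = β b → Tendsto τ (𝓝[f ⁻¹' (V ∩ R₀)] a) (𝓝 b) := by
  have hev := hcov (f a) ha.2
  have := hev.1
  have : Nonempty (f ⁻¹' {f a}) := ⟨⟨a, rfl⟩⟩
  let e := hev.toTrivialization
  have hae : f a ∈ e.baseSet := hev.mem_toTrivialization_baseSet
  let N := connectedComponentIn (V ∩ R ∩ e.baseSet) (f a)
  have hNo : IsOpen N := ((hV.inter hR).inter e.open_baseSet).connectedComponentIn
  have haN : f a ∈ N := mem_connectedComponentIn ⟨ha, hae⟩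
  have hN : N ⊆ V ∩ R ∩ e.baseSet := connectedComponentIn_subset _ _
  have hNR₀ : IsConnected (N ∩ R₀) := by
    have := hsep N hNo (isConnected_connectedComponentIn_iff.2 ⟨ha, hae⟩)
    rwa [sdiff_compl] at this
  obtain ⟨s, hsN, hsR⟩ := hNR₀.nonempty
  have hse : s ∈ e.baseSet := (hN hsN).2
  have hlift (z : X) {y : Y} (hy : y ∈ e.baseSet) : (e (e.lift z y)).2 = (e z).2 := by
    change (e (e.toOpenPartialHomeomorph.symm (y, (e z).2))).2 = _
    rw [e.apply_symm_apply' hy]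
  have hlift_eq {w z : X} (hw : f w ∈ e.baseSet) (h : (e w).2 = (e z).2) :
      e.lift z (f w) = w := by
    conv_rhs => rw [← e.lift_self hw]
    exact congrArg (fun i => e.invFun (f w, i)) h.symm
  refine ⟨s, ⟨(hN hsN).1.1, hsR⟩, fun b => e.lift b s, fun b _ => e.proj_lift hse, fun c hc => ?_,
    fun τ hτ hfτ b hb hab => ?_⟩
  · refine ⟨e.lift c (f a), e.proj_lift hae, ?_⟩
    subst hc
    exact hlift_eq hse (hlift _ hae).symm
  · have hbe : f b ∈ e.baseSet := by rwa [hb]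
    rw [e.tendsto_nhds_iff (e.mem_source.2 hbe)]
    constructor
    · rw [hb]
      refine Tendsto.congr' ?_ ((hcov.continuousAt ha.2).tendsto.mono_left nhdsWithin_le_nhds)
      filter_upwards [self_mem_nhdsWithin] with w hw using (hfτ w hw).symm
    · have hmaps : MapsTo (e.lift a) (N ∩ R₀) (f ⁻¹' (V ∩ R₀)) := fun y hy => by
        rw [mem_preimage, e.proj_lift (hN hy.1).2]
        exact ⟨(hN hy.1).1.1, hy.2⟩
      -- The sheet index of `τ` along the sheet of `a` is a continuous map from the connected set `N
      -- ∩ R₀` to a discrete fibre, hence constant; at `s` it is the sheet of `b`.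
      have hk : ContinuousOn (fun y => (e (τ (e.lift a y))).2) (N ∩ R₀) := by
        have h₁ : ContinuousOn (e.lift a) (N ∩ R₀) :=
          (e.continuousOn_symm_prodMk_left (v := (e a).2)).mono fun y hy => (hN hy.1).2
        refine continuous_snd.comp_continuousOn (e.continuousOn_toFun.comp (hτ.comp h₁ hmaps) ?_)
        intro y hy
        change τ (e.lift a y) ∈ e.source
        rw [e.mem_source, hfτ _ (hmaps hy), e.proj_lift (hN hy.1).2]
        exact (hN hy.1).2
      have hfib : ∀ᶠ w in 𝓝 a, (e w).2 = (e a).2 := by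
        have := ((e.tendsto_nhds_iff (e.mem_source.2 hae)).1 tendsto_id).2
        rw [nhds_discrete (f ⁻¹' {f a}), tendsto_pure] at this
        exact this
      refine tendsto_nhds_of_eventually_eq ?_
      filter_upwards [self_mem_nhdsWithin, nhdsWithin_le_nhds hfib,
        nhdsWithin_le_nhds ((hcov.continuousAt ha.2).preimage_mem_nhds (hNo.mem_nhds haN))]
        with w hw hwa hwN
      have := hNR₀.isPreconnected.constant hk ⟨hwN, hw.2⟩ ⟨hsN, hsR⟩
      simp only [hlift_eq (hN hwN).2 hwa, hab, hlift b hse] at this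
      exact this

end Extension

/-! ### Normality from deck transformations over fewer values -/

section Production
variable {X : Type u} {Y : Type v} [TopologicalSpace X] [TopologicalSpace Y] {f : X → Y}

/-- Each transformation has a limit at every point over `V ∩ R` by sheet comparison, hence extends
continuously; the inverse relations pass to the limit by density. Transitivity on a fibre is read
off from a nearby fibre over `R₀`. -/
theorem IsDeckPair.extend [T2Space X] [RegularSpace X] [T2Space Y] [LocallyConnectedSpace Y]
    {R R₀ V : Set Y} (hf : Continuous f)
    (hcov : IsCoveringMapOn f R) (hR : IsOpen R) (hR₀ : R₀ ⊆ R) (hsep : NotLocallySeparating R₀ᶜ)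
    (hdense : Dense (f ⁻¹' R₀)) (hV : IsOpen V)
    (hdeck : ∀ a b, f a ∈ V ∩ R₀ → f a = f b →
      ∃ τ τ', IsDeckPair f (f ⁻¹' (V ∩ R₀)) τ τ' ∧ τ a = b) {a b : X}
    (ha : f a ∈ V ∩ R) (hab : f a = f b) :
    ∃ τ τ', IsDeckPair f (f ⁻¹' (V ∩ R)) τ τ' ∧ τ a = b := by
  let Z := f ⁻¹' (V ∩ R)
  let Z₀ := f ⁻¹' (V ∩ R₀)
  have hZ₀ : Z₀ ⊆ Z := preimage_mono (inter_subset_inter_right _ hR₀)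
  have hcl : Z ⊆ closure Z₀ := fun x hx =>
    hdense.open_subset_closure_inter (hV.preimage hf) hx.1
  have hlim {τ τ' : X → X} (h : IsDeckPair f Z₀ τ τ') {x : X} (hx : x ∈ Z) :
      ∃ y, f y = f x ∧ Filter.Tendsto τ (𝓝[Z₀] x) (𝓝 y) := by
    obtain ⟨s, hs, β, hβ, hβ', hlim⟩ := exists_sheet_comparison hcov hR hsep hV hx
    have hβx : β x ∈ Z₀ := by rw [mem_preimage, hβ x rfl]; exact hs
    obtain ⟨y, hy, hyβ⟩ := hβ' (τ (β x)) (by rw [h.map_eq _ hβx, hβ x rfl])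
    exact ⟨y, hy, hlim τ h.continuousOn h.map_eq y hy hyβ.symm⟩
  have hcont {τ τ' : X → X} (h : IsDeckPair f Z₀ τ τ') : ContinuousOn (extendFrom Z₀ τ) Z :=
    continuousOn_extendFrom hcl fun x hx => (hlim h hx).imp fun _ => And.right
  have hfext {τ τ' : X → X} (h : IsDeckPair f Z₀ τ τ') (x : X) (hx : x ∈ Z) :
      f (extendFrom Z₀ τ x) = f x := by
    obtain ⟨y, hy, hxy⟩ := hlim h hx
    rw [extendFrom_eq (hcl hx) hxy, hy]
  have hmaps {τ τ' : X → X} (h : IsDeckPair f Z₀ τ τ') : MapsTo (extendFrom Z₀ τ) Z Z :=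
    fun x hx => by
      rw [mem_preimage, hfext h x hx]
      exact hx
  have hinv {τ τ' : X → X} (h : IsDeckPair f Z₀ τ τ') :
      LeftInvOn (extendFrom Z₀ τ') (extendFrom Z₀ τ) Z := by
    refine Set.EqOn.of_subset_closure (s := Z₀) (f := extendFrom Z₀ τ' ∘ extendFrom Z₀ τ) (g := id)
      (fun x hx => ?_) ((hcont h.symm).comp (hcont h) (hmaps h)) continuousOn_id hZ₀ hcl
    rw [Function.comp_apply, extendFrom_extends h.continuousOn x hx,
      extendFrom_extends h.continuousOn_symm _ (h.mapsTo hx)]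
    exact h.leftInv hx
  obtain ⟨s, hs, β, hβ, -, hβlim⟩ := exists_sheet_comparison hcov hR hsep hV ha
  obtain ⟨τ, τ', h, hτ⟩ := hdeck (β a) (β b) (by rw [hβ a rfl]; exact hs)
    (by rw [hβ a rfl, hβ b hab.symm])
  exact ⟨extendFrom Z₀ τ, extendFrom Z₀ τ', ⟨hcont h, hcont h.symm, hmaps h, hmaps h.symm, hfext h,
    hfext h.symm, hinv h, hinv h.symm⟩, extendFrom_eq (hcl ha)
      (hβlim τ h.continuousOn h.map_eq b hab.symm hτ)⟩

/-- Intended for `R₀ = regularValues (f ∘ p)`, which may be smaller than the regular values of `f`.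
Connectedness passes up because the larger preimage lies in the closure of the smaller. -/
theorem isNormalBranchedOn_of_isDeckPair (hf : IsBranchedCovering f) (hfp : HasCompactPreimages f)
    [T2Space X] [RegularSpace X] [T2Space Y] [LocallyCompactSpace Y] [LocallyConnectedSpace Y]
    {R₀ V : Set Y} (hR₀ : R₀ ⊆ regularValues f) (hsep : NotLocallySeparating R₀ᶜ)
    (hdense : Dense (f ⁻¹' R₀)) (hV : IsOpen V) (hconn : IsConnected (f ⁻¹' (V ∩ R₀)))
    (hdeck : ∀ a b, f a ∈ V ∩ R₀ → f a = f b →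
      ∃ τ τ', IsDeckPair f (f ⁻¹' (V ∩ R₀)) τ τ' ∧ τ a = b) :
    IsNormalBranchedOn f (f ⁻¹' V) := by
  have hclosed := hfp.isClosedMap hf.continuous
  have hR := regularValues_imageFactorization hf.continuous hf.isOpenMap hV
  have hcov : IsCoveringMapOn f (regularValues f) :=
    hclosed.isCoveringMapOn_of_isLocalHomeomorphOn (fun y _ => hfp.finite_fiber hf y)
      isLocalHomeomorphOn_preimage_regularValues
  let F := imageFactorization f (f ⁻¹' V)
  let R := regularValues F
  have hmem {x : X} (hx : f x ∈ V ∩ regularValues f) : F ⟨x, hx.1⟩ ∈ R := by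
    rw [show R = _ from hR]
    exact hx.2
  have hmem' {x : f ⁻¹' V} (hx : F x ∈ R) : f x.1 ∈ V ∩ regularValues f := by
    rw [show R = _ from hR] at hx
    exact ⟨x.2, hx⟩
  have hcl : IsClosedMap F := by
    intro C hC
    obtain ⟨C', hC', rfl⟩ := isClosed_induced_iff.1 hC
    refine isClosed_induced_iff.2 ⟨f '' C', hclosed _ hC', ?_⟩
    ext ⟨y, x₀, hx₀, rfl⟩
    constructor
    · rintro ⟨x, hx, hxy⟩
      have hxV : x ∈ f ⁻¹' V := by
        rw [mem_preimage, hxy]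
        exact hx₀
      exact ⟨⟨x, hxV⟩, hx, Subtype.ext hxy⟩
    · rintro ⟨x, hx, hxy⟩
      exact ⟨x, hx, congrArg Subtype.val hxy⟩
  have hfin (y) : (F ⁻¹' {y}).Finite := by
    refine Set.Finite.of_finite_image
      ((hfp.finite_fiber hf y.1).subset ?_) Subtype.val_injective.injOn
    rintro _ ⟨x, hx, rfl⟩
    exact congrArg Subtype.val hx
  refine ⟨(hcl.isCoveringMapOn_of_isLocalHomeomorphOn (fun y _ => hfin y)
    isLocalHomeomorphOn_preimage_regularValues).isCoveringMap_restrictPreimage, ?_, ?_, ?_⟩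
  · rintro ⟨⟨_, x, hx, rfl⟩, hy⟩
    exact ⟨⟨⟨x, hx⟩, hy⟩, rfl⟩
  · have hZ : IsConnected (f ⁻¹' (V ∩ regularValues f)) :=
      hconn.subset_closure (preimage_mono (inter_subset_inter_right _ hR₀)) fun x hx =>
        hdense.open_subset_closure_inter (hV.preimage hf.continuous) hx.1
    have := isConnected_iff_connectedSpace.1 hZ
    refine Function.Surjective.connectedSpace
      (f := fun x : f ⁻¹' (V ∩ regularValues f) => (⟨⟨x.1, x.2.1⟩, hmem x.2⟩ : F ⁻¹' R)) ?_
      (by fun_prop)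
    rintro ⟨x, hx⟩
    exact ⟨⟨x.1, hmem' hx⟩, rfl⟩
  · rintro ⟨a, ha⟩ ⟨b, hb⟩ hab
    have hab' : f a.1 = f b.1 := congrArg (fun t => t.1.1) hab
    obtain ⟨τ, τ', h, hτ⟩ := IsDeckPair.extend hf.continuous hcov (isOpen_regularValues hclosed)
      hR₀ hsep hdense hV hdeck (hmem' ha) hab'
    let mk (σ : X → X) (hσ : MapsTo σ (f ⁻¹' (V ∩ regularValues f))
      (f ⁻¹' (V ∩ regularValues f))) (x : F ⁻¹' R) : F ⁻¹' R :=
      ⟨⟨σ x.1.1, (hσ (hmem' x.2)).1⟩, hmem (hσ (hmem' x.2))⟩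
    have hcont (σ : X → X) (hσ) (hc : ContinuousOn σ (f ⁻¹' (V ∩ regularValues f))) :
        Continuous (mk σ hσ) :=
      Continuous.subtype_mk (Continuous.subtype_mk
        (hc.comp_continuous (by fun_prop) fun x => hmem' x.2) _) _
    refine ⟨⟨⟨mk τ h.mapsTo, mk τ' h.mapsTo_symm, fun x => ?_, fun x => ?_⟩,
      hcont _ h.mapsTo h.continuousOn, hcont _ h.mapsTo_symm h.continuousOn_symm⟩, fun x => ?_, ?_⟩
    · exact Subtype.ext (Subtype.ext (h.leftInv (hmem' x.2)))
    · exact Subtype.ext (Subtype.ext (h.rightInv (hmem' x.2)))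
    · exact Subtype.ext (Subtype.ext (h.map_eq _ (hmem' x.2)))
    · exact Subtype.ext (Subtype.ext hτ)

end Production

/-! ### Descending deck transformations from `f ∘ p` to `f` -/

section Propagation

variable {X : Type u} {Y : Type v} {Xf : Type w} [TopologicalSpace X] [TopologicalSpace Y]
  [TopologicalSpace Xf] {f : X → Y} {p : Xf → X}

/-- Uniqueness of lifts: `f` is locally injective over its regular values and `X` is Hausdorff. -/
theorem eqOn_of_comp_eqOn_regularValues [T2Space X] {A : Type*} [TopologicalSpace A] {C : Set A}
    (hC : IsPreconnected C) {u v : A → X} (hu : ContinuousOn u C) (hv : ContinuousOn v C)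
    (hR : ∀ c ∈ C, f (u c) ∈ regularValues f) (h : ∀ c ∈ C, f (u c) = f (v c)) {c₀ : A}
    (hc₀ : c₀ ∈ C) (h₀ : u c₀ = v c₀) : EqOn u v C := by
  have hinj : IsLocallyInjective fun x : f ⁻¹' regularValues f => f x := fun x => by
    obtain ⟨e, hxe, he⟩ := isLocalHomeomorphOn_preimage_regularValues x.1 x.2
    refine ⟨Subtype.val ⁻¹' e.source, e.open_source.preimage continuous_subtype_val, hxe,
      fun a ha b hb hab => Subtype.ext (e.injOn ha hb ?_)⟩
    rw [← he]
    exact hab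
  have := isPreconnected_iff_preconnectedSpace.1 hC
  rw [continuousOn_iff_continuous_domRestrict] at hu hv
  have hR' (c) (hc : c ∈ C) : f (v c) ∈ regularValues f := h c hc ▸ hR c hc
  let u' (c : C) : f ⁻¹' regularValues f := ⟨u c, hR c c.2⟩
  let v' (c : C) : f ⁻¹' regularValues f := ⟨v c, hR' c c.2⟩
  have key : u' = v' := (T2Space.isSeparatedMap fun x : f ⁻¹' regularValues f => f x).eq_of_comp_eq
    hinj (hu.subtype_mk _) (hv.subtype_mk _) (funext fun c => h c c.2) ⟨c₀, hc₀⟩ (Subtype.ext h₀)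
  exact fun c hc => congrArg Subtype.val (congrFun key ⟨c, hc⟩)

theorem IsOpenMap.exists_continuousOn_descent {A B C : Type*} [TopologicalSpace A]
    [TopologicalSpace B] [TopologicalSpace C] [Nonempty A] {q : A → B} (hq : IsOpenMap q)
    {K : Set A} (hK : IsOpen K) {g : A → C} (hg : ContinuousOn g K)
    (hconst : ∀ z ∈ K, ∀ z' ∈ K, q z = q z' → g z = g z') :
    ∃ τ : B → C, ContinuousOn τ (q '' K) ∧ ∀ z ∈ K, τ (q z) = g z := by
  have hτ (z) (hz : z ∈ K) : g (Function.invFunOn q K (q z)) = g z :=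
    hconst _ (Function.invFunOn_mem ⟨z, hz, rfl⟩) _ hz (Function.invFunOn_eq ⟨z, hz, rfl⟩)
  refine ⟨fun b => g (Function.invFunOn q K b), ?_, hτ⟩
  rintro _ ⟨z, hz, rfl⟩ U hU
  simp only [hτ z hz] at hU
  have hzU : K ∩ g ⁻¹' U ∈ 𝓝 z :=
    Filter.inter_mem (hK.mem_nhds hz) ((hg.continuousAt (hK.mem_nhds hz)).preimage_mem_nhds hU)
  refine Filter.mem_map.2 (mem_nhdsWithin_of_mem_nhds (Filter.mem_of_superset
    (hq.image_mem_nhds hzU) ?_))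
  rintro _ ⟨w, hw, rfl⟩
  rw [mem_preimage, hτ w hw.1]
  exact hw.2

/-- The image of the connected part is connected, stays over `S` and meets the component in `τ z`,
so it cannot leave it. -/
theorem mapsTo_connectedComponentIn {B : Type*} {q : Xf → B} {Z : Set Xf} {τ : Xf → Xf}
    (hτ : ContinuousOn τ Z) (hq : ∀ x ∈ Z, q (τ x) = q x) (hm : MapsTo τ Z Z) {S : Set B} {x : Xf}
    (hpre : IsPreconnected (connectedComponentIn (q ⁻¹' S) x ∩ Z)) {z : Xf}
    (hz : z ∈ connectedComponentIn (q ⁻¹' S) x ∩ Z)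
    (hτz : τ z ∈ connectedComponentIn (q ⁻¹' S) x) :
    MapsTo τ (connectedComponentIn (q ⁻¹' S) x ∩ Z) (connectedComponentIn (q ⁻¹' S) x ∩ Z) := by
  refine fun w hw => ⟨?_, hm hw.2⟩
  rw [connectedComponentIn_eq hτz]
  refine (hpre.image τ (hτ.mono inter_subset_right)).subset_connectedComponentIn
    (mem_image_of_mem τ hz) ?_ (mem_image_of_mem τ hw)
  rintro _ ⟨c, hc, rfl⟩
  rw [mem_preimage, hq c hc.2]
  exact connectedComponentIn_subset (q ⁻¹' S) x hc.1

theorem IsDeckPair.mono {S T : Type*} [TopologicalSpace S] {q : S → T} {A B : Set T}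
    {τ τ' : S → S} (h : IsDeckPair q (q ⁻¹' A) τ τ') (hBA : B ⊆ A) :
    IsDeckPair q (q ⁻¹' B) τ τ' := by
  have hs : q ⁻¹' B ⊆ q ⁻¹' A := preimage_mono hBA
  refine ⟨h.1.mono hs, h.2.mono hs, fun x hx => ?_, fun x hx => ?_, fun x hx => h.map_eq x (hs hx),
    fun x hx => h.map_symm_eq x (hs hx), fun x hx => h.leftInv (hs hx),
    fun x hx => h.rightInv (hs hx)⟩
  · rw [mem_preimage, h.map_eq x (hs hx)]
    exact hx
  · rw [mem_preimage, h.map_symm_eq x (hs hx)]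
    exact hx

/-- If `f` is normal over `M ⊆ S` and the part over `M` of a component `T` over `S` is connected,
then the deck transformations of `f ∘ p` preserving `T` descend to deck transformations of `f`
over `S`. -/
theorem exists_isDeckPair_of_subset [T2Space X] [Nonempty Xf] (hf : Continuous f)
    (hfo : IsOpenMap f) (hp : Continuous p) (hpo : IsOpenMap p) (hps : Function.Surjective p)
    (hpn : IsNormalBranched p) (hfpn : IsNormalBranched (f ∘ p))
    (hRo : IsOpen (regularValues (f ∘ p))) {S M : Set Y} {x : Xf}
    (hM : IsOpen M) {T : Set Xf} (hT : T = connectedComponentIn (f ∘ p ⁻¹' S) x)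
    (hTo : IsOpen T) (hTp : p '' T = f ⁻¹' S)
    (hTc : IsPreconnected (T ∩ f ∘ p ⁻¹' regularValues (f ∘ p)))
    (hTM : IsConnected (T ∩ f ∘ p ⁻¹' M ∩ f ∘ p ⁻¹' regularValues (f ∘ p)))
    (hn : IsNormalBranchedOn f (f ⁻¹' M)) {a b : X} (ha : f a ∈ S ∩ regularValues (f ∘ p))
    (hab : f a = f b) :
    ∃ τ τ', IsDeckPair f (f ⁻¹' (S ∩ regularValues (f ∘ p))) τ τ' ∧ τ a = b := by
  let R := regularValues (f ∘ p)
  let Z := f ∘ p ⁻¹' R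
  have hZo : IsOpen Z := hRo.preimage (hf.comp hp)
  have hR : R ⊆ regularValues f := regularValues_comp_subset hf hfo hp hpo hps
  have hRp : f ⁻¹' R ⊆ regularValues p := preimage_regularValues_comp_subset hf hfo hp hpo
  have hTS : T ⊆ f ∘ p ⁻¹' S := hT ▸ connectedComponentIn_subset _ _
  have himage : p '' (T ∩ Z) = f ⁻¹' (S ∩ R) := by
    rw [show T ∩ Z = T ∩ p ⁻¹' (f ⁻¹' R) from rfl, image_inter_preimage, hTp, preimage_inter]
  have hmaps {g g' : Xf → Xf} (hg : IsDeckPair (f ∘ p) Z g g') {z} (hz : z ∈ T ∩ Z)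
      (hgz : g z ∈ T) : MapsTo g (T ∩ Z) (T ∩ Z) := by
    subst hT
    exact mapsTo_connectedComponentIn hg.continuousOn hg.map_eq hg.mapsTo hTc hz hgz
  have hZf {z : Xf} (hz : z ∈ Z) : f (p z) ∈ regularValues f := hR hz
  /- compatibility over `M` -/
  have hcompM {g g' : Xf → Xf} (hg : IsDeckPair (f ∘ p) Z g g')
      (z) (hz : z ∈ T ∩ f ∘ p ⁻¹' M ∩ Z) (z') (hz' : z' ∈ T ∩ f ∘ p ⁻¹' M ∩ Z)
      (hzz' : p z = p z') : p (g z) = p (g z') := by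
    obtain ⟨δ, hδc, hδf, hδ⟩ := hn.exists_deck hf hfo hM (a := p z) (b := p (g z))
      ⟨hz.1.2, hZf hz.2⟩ (hg.map_eq z hz.2).symm
    have hpM : MapsTo p (T ∩ f ∘ p ⁻¹' M ∩ Z) (f ⁻¹' (M ∩ regularValues f)) :=
      fun w hw => ⟨hw.1.2, hZf hw.2⟩
    -- Both maps lift `f ∘ p` through `f` and agree at `z`. Thus `p ∘ g` factors through `p` over
    -- `M`.
    have heq : EqOn (p ∘ g) (δ ∘ p) (T ∩ f ∘ p ⁻¹' M ∩ Z) := by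
      refine eqOn_of_comp_eqOn_regularValues (f := f) hTM.isPreconnected
        (hp.comp_continuousOn (hg.continuousOn.mono inter_subset_right))
        (hδc.comp hp.continuousOn hpM) (fun c hc => hZf (hg.mapsTo hc.2)) (fun c hc => ?_) hz
        hδ.symm
      exact (hg.map_eq c hc.2).trans (hδf _ (hpM hc)).symm
    exact (heq hz).trans ((congrArg δ hzz').trans (heq hz').symm)
  have hcomp {g g' : Xf → Xf} (hg : IsDeckPair (f ∘ p) Z g g')
      (z) (hz : z ∈ T ∩ Z) (z') (hz' : z' ∈ T ∩ Z)
      (hzz' : p z = p z') : p (g z) = p (g z') := by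
    obtain ⟨h, h', hh, hhz⟩ := hpn.exists_isDeckPair (hRp hz.2) hzz'
    have hZp : Z ⊆ p ⁻¹' regularValues p := fun w hw => hRp hw
    have hhZ : IsDeckPair (f ∘ p) Z h h' := by
      have := hh.mono (B := f ⁻¹' R) hRp
      exact ⟨this.1, this.2, this.3, this.4, fun w hw => congrArg f (this.map_eq w hw),
        fun w hw => congrArg f (this.map_symm_eq w hw), this.7, this.8⟩
    have hhT : MapsTo h (T ∩ Z) (T ∩ Z) := hmaps hhZ hz (hhz ▸ hz'.1)
    obtain ⟨c, hc⟩ := hTM.nonempty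
    -- The deck transformation `h` of `p` takes `z` to `z'`. The two lifts agree at a point `c` over
    -- `M`, by the case already settled, hence on all of the connected `T ∩ Z`.
    have heq : EqOn (p ∘ g ∘ h) (p ∘ g) (T ∩ Z) := by
      refine eqOn_of_comp_eqOn_regularValues (f := f) hTc
        (hp.comp_continuousOn ((hg.continuousOn.comp hhZ.continuousOn hhZ.mapsTo).mono
          inter_subset_right))
        (hp.comp_continuousOn (hg.continuousOn.mono inter_subset_right))
        (fun c hc => hZf (hg.mapsTo (hhZ.mapsTo hc.2))) (fun c hc => ?_)
        (c₀ := c) ⟨hc.1.1, hc.2⟩ ?_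
      · exact (hg.map_eq _ (hhZ.mapsTo hc.2)).trans
          ((hhZ.map_eq _ hc.2).trans (hg.map_eq _ hc.2).symm)
      · refine hcompM hg _ ⟨⟨(hhT ⟨hc.1.1, hc.2⟩).1, ?_⟩, hhZ.mapsTo hc.2⟩ _ hc
          (hh.map_eq _ (hZp hc.2))
        rw [mem_preimage, hhZ.map_eq _ hc.2]
        exact hc.1.2
    rw [← hhz]
    exact (heq hz).symm
  have hb : f b ∈ S ∩ R := hab ▸ ha
  obtain ⟨za, hza, rfl⟩ : a ∈ p '' (T ∩ Z) := himage ▸ ha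
  obtain ⟨zb, hzb, rfl⟩ : b ∈ p '' (T ∩ Z) := himage ▸ hb
  obtain ⟨g, g', hg, hgz⟩ := hfpn.exists_isDeckPair hza.2 hab
  have hgT : MapsTo g (T ∩ Z) (T ∩ Z) := hmaps hg hza (hgz ▸ hzb.1)
  have hgT' : MapsTo g' (T ∩ Z) (T ∩ Z) := by
    refine hmaps hg.symm hzb ?_
    rw [← hgz, hg.leftInv hza.2]
    exact hza.1
  obtain ⟨τ, hτc, hτ⟩ := hpo.exists_continuousOn_descent (hTo.inter hZo) (g := p ∘ g)
    (hp.comp_continuousOn (hg.continuousOn.mono inter_subset_right)) (hcomp hg)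
  obtain ⟨τ', hτc', hτ'⟩ := hpo.exists_continuousOn_descent (hTo.inter hZo) (g := p ∘ g')
    (hp.comp_continuousOn (hg.symm.continuousOn.mono inter_subset_right)) (hcomp hg.symm)
  rw [himage] at hτc hτc'
  have hrep {c : X} (hc : c ∈ f ⁻¹' (S ∩ R)) : ∃ z ∈ T ∩ Z, p z = c := by rwa [← himage] at hc
  refine ⟨τ, τ', ⟨hτc, hτc', fun c hc => ?_, fun c hc => ?_, fun c hc => ?_, fun c hc => ?_,
    fun c hc => ?_, fun c hc => ?_⟩, ?_⟩
  · obtain ⟨z, hz, rfl⟩ := hrep hc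
    rw [hτ z hz]
    exact himage ▸ mem_image_of_mem p (hgT hz)
  · obtain ⟨z, hz, rfl⟩ := hrep hc
    rw [hτ' z hz]
    exact himage ▸ mem_image_of_mem p (hgT' hz)
  · obtain ⟨z, hz, rfl⟩ := hrep hc
    rw [hτ z hz]
    exact hg.map_eq z hz.2
  · obtain ⟨z, hz, rfl⟩ := hrep hc
    rw [hτ' z hz]
    exact hg.map_symm_eq z hz.2
  · obtain ⟨z, hz, rfl⟩ := hrep hc
    rw [hτ z hz, Function.comp_apply, hτ' _ (hgT hz), Function.comp_apply, hg.leftInv hz.2]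
  · obtain ⟨z, hz, rfl⟩ := hrep hc
    rw [hτ' z hz, Function.comp_apply, hτ _ (hgT' hz), Function.comp_apply, hg.rightInv hz.2]
  · rw [hτ za hza, Function.comp_apply, hgz]

end Propagation

/-! ### Path connectedness and small components -/

section Local

variable {X : Type u} {Y : Type v} [TopologicalSpace X] [TopologicalSpace Y] {q : X → Y}

/-- Local path connectedness is pulled back from `Y` through local homeomorphisms. It supplies paths
in `Xf`, which is only assumed locally connected, off the branching. -/
theorem IsLocalHomeomorphOn.isPathConnected [LocallyPathConnectedSpace Y] {C : Set X}
    (hq : IsLocalHomeomorphOn q C) (hC : IsOpen C) (hCc : IsConnected C) : IsPathConnected C := by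
  have : LocallyPathConnectedSpace C := by
    refine locallyPathConnectedSpace_iff_pathComponentIn_mem_nhds.2 fun x u hu hxu => ?_
    obtain ⟨e, hxe, -⟩ := hq x x.2
    have hs : IsOpen (Subtype.val ⁻¹' e.source : Set C) :=
      e.open_source.preimage continuous_subtype_val
    have he : IsOpenEmbedding fun z : (Subtype.val ⁻¹' e.source : Set C) => e z.1.1 := by
      have h₁ : IsOpenEmbedding fun z : (Subtype.val ⁻¹' e.source : Set C) =>
          (⟨z.1.1, z.2⟩ : e.source) := by
        refine .of_comp _ e.open_source.isOpenEmbedding_subtypeVal ?_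
        exact hC.isOpenEmbedding_subtypeVal.comp hs.isOpenEmbedding_subtypeVal
      exact e.isOpenEmbedding_restrict.comp h₁
    have := he.locallyPathConnectedSpace
    let x' : (Subtype.val ⁻¹' e.source : Set C) := ⟨x, hxe⟩
    obtain ⟨N, ⟨hN, hNc⟩, hNu⟩ := (path_connected_basis x').mem_iff.1
      ((hu.preimage continuous_subtype_val).mem_nhds (show x' ∈ Subtype.val ⁻¹' u from hxu))
    refine Filter.mem_of_superset (hs.isOpenEmbedding_subtypeVal.image_mem_nhds.2 hN) ?_
    exact (hNc.image continuous_subtype_val).subset_pathComponentIn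
      (mem_image_of_mem _ (mem_of_mem_nhds hN)) (image_subset_iff.2 hNu)
  rw [isPathConnected_iff_pathConnectedSpace, pathConnectedSpace_iff_connectedSpace]
  exact isConnected_iff_connectedSpace.1 hCc

/-- Separate `x` from the rest of its finite fibre by disjoint open sets. Closedness keeps the
preimage of a small `U` inside their union, and a connected set through `x` stays on the side of
`x`. -/
theorem IsClosedMap.exists_nhds_forall_isPreconnected_subset [T2Space X] (hq : IsClosedMap q)
    {x : X} (hfin : (q ⁻¹' {q x}).Finite) {N : Set X} (hN : IsOpen N) (hxN : x ∈ N) :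
    ∃ U ∈ 𝓝 (q x), ∀ D : Set X, IsPreconnected D → x ∈ D → D ⊆ q ⁻¹' U → D ⊆ N := by
  obtain ⟨A, B, hA, hB, hxA, hFB, hAB⟩ := SeparatedNhds.of_isCompact_isCompact
    (isCompact_singleton (x := x)) (hfin.sdiff (t := {x})).isCompact
    disjoint_sdiff_right
  have hO : IsOpen ((A ∩ N) ∪ B) := (hA.inter hN).union hB
  refine ⟨(q '' ((A ∩ N) ∪ B)ᶜ)ᶜ, (hq _ hO.isClosed_compl).isOpen_compl.mem_nhds ?_,
    fun D hD hxD hDU => ?_⟩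
  · rintro ⟨z, hz, hzx⟩
    by_cases h : z = x
    · exact hz (Or.inl ⟨h ▸ hxA rfl, h ▸ hxN⟩)
    · exact hz (Or.inr (hFB ⟨hzx, h⟩))
  · have hDO : D ⊆ (A ∩ N) ∪ B := fun z hz => by_contra fun h => hDU hz ⟨z, h, rfl⟩
    exact (hD.subset_left_of_subset_union (hA.inter hN) hB (hAB.mono_left inter_subset_left) hDO
      ⟨x, hxD, hxA rfl, hxN⟩).trans inter_subset_right

end Local

/-! ### Connectedness after removing a small neighbourhood -/

section Neighbourhood

variable {X : Type u} {Y : Type v} [TopologicalSpace X] [TopologicalSpace Y] {q : X → Y}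

theorem IsProperCompletedCovering.isConnected_inter (hq : IsProperCompletedCovering q) {C : Set X}
    (hC : IsOpen C) (hCc : IsConnected C) : IsConnected (C ∩ q ⁻¹' regularValues q) := by
  have := hq.source_notLocallySeparating C hC hCc
  rwa [sdiff_compl] at this

theorem IsProperCompletedCovering.isPathConnected_inter [T2Space Y] [LocallyCompactSpace Y]
    [LocallyPathConnectedSpace Y] (hq : IsProperCompletedCovering q) {C : Set X}
    (hC : IsOpen C) (hCc : IsConnected C) : IsPathConnected (C ∩ q ⁻¹' regularValues q) := by
  have hqc := hq.isBranchedCovering.continuous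
  exact (isLocalHomeomorphOn_preimage_regularValues.mono inter_subset_right).isPathConnected
    (hC.inter ((isOpen_regularValues (hq.proper.isClosedMap hqc)).preimage hqc))
    (hq.isConnected_inter hC hCc)

/-- If `L` covers `V` up to a sufficiently small neighbourhood of `q x`, then the part over `L` of
the component of `x` over `V` is connected. -/
theorem IsProperCompletedCovering.exists_nhds_isConnected_inter [T2Space Y] [LocallyCompactSpace Y]
    [LocallyPathConnectedSpace Y] [LocallyConnectedSpace X] (hq : IsProperCompletedCovering q)
    {V : Set Y} (hV : IsOpen V) (hVc : IsConnected V) {x : X} (hxV : q x ∈ V)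
    (hinj : q x ∈ regularValues q → InjOn q (connectedComponentIn (q ⁻¹' V) x)) :
    ∃ U ∈ 𝓝 (q x), ∀ S L : Set Y, V = S ∪ L → IsOpen L → IsConnected L → S ⊆ U →
      IsConnected (connectedComponentIn (q ⁻¹' V) x ∩ q ⁻¹' L) := by
  have hqc := hq.isBranchedCovering.continuous
  have hqo := hq.isBranchedCovering.isOpenMap
  have hqcl := hq.proper.isClosedMap hqc
  let D := connectedComponentIn (q ⁻¹' V) x
  have hDo : IsOpen D := (hV.preimage hqc).connectedComponentIn
  have hDc : IsConnected D := isConnected_connectedComponentIn_iff.2 hxV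
  have hD : q '' D = V := image_connectedComponentIn_preimage hqc hqo hqcl hV hVc.isPreconnected hxV
  by_cases hx : q x ∈ regularValues q
  -- Here `q` is injective and open on `D`, so the part over `L` is a copy of `L`.
  · refine ⟨V, hV.mem_nhds hxV, fun S L hSL hL hLc _ => ?_⟩
    have := hLc.preimage_of_isOpenMap (f := fun z : D => q z) (injOn_iff_injective.1 (hinj hx))
      (hqo.comp hDo.isOpenMap_subtype_val) (by
        have : range (fun z : D => q z) = V := by rw [← hD, image_eq_range]
        rw [this, hSL]
        exact subset_union_right)
    convert this.image Subtype.val continuous_subtype_val.continuousOn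
    ext z
    simp [D, and_comm]
  · obtain ⟨b, hbV, hbR⟩ := hq.dense_target.inter_open_nonempty V hV hVc.nonempty
    have hpc := hq.isPathConnected_inter hDo hDc
    obtain ⟨z₀, hz₀⟩ := hpc.nonempty
    let F := D ∩ q ⁻¹' {b}
    have hF : F.Finite :=
      (hq.proper.finite_fiber hq.isBranchedCovering b).subset inter_subset_right
    have hFG (z : X) (hz : z ∈ F) : ∃ G : Set X, IsCompact G ∧ IsPreconnected G ∧
        G ⊆ D ∩ q ⁻¹' regularValues q ∧ z₀ ∈ G ∧ z ∈ G := by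
      have hJ := hpc.joinedIn _ hz₀ _ ⟨hz.1, by rw [mem_preimage, hz.2]; exact hbR⟩
      exact ⟨range hJ.somePath, isCompact_range hJ.somePath.continuous,
        isPreconnected_range hJ.somePath.continuous, range_subset_iff.2 hJ.somePath_mem,
        ⟨0, hJ.somePath.source⟩, ⟨1, hJ.somePath.target⟩⟩
    choose! G hGk hGc hGD hG₀ hG₁ using hFG
    -- Finitely many paths join `z₀` to the points of `D` over `b`. They run over regular values, so
    -- their compact image misses the nonregular `q x`, and `S` is kept away from it.
    let K := ⋃ z ∈ F, q '' G z
    have hK : IsCompact K := hF.isCompact_biUnion fun z hz => (hGk z hz).image hqc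
    have hxK : q x ∉ K := fun h => by
      obtain ⟨z, hz, w, hw, hwx⟩ := mem_iUnion₂.1 h
      exact hx (hwx ▸ (hGD z hz hw).2)
    refine ⟨Kᶜ, hK.isClosed.isOpen_compl.mem_nhds hxK, fun S L hSL hL hLc hS => ?_⟩
    have hGL {z : X} (hz : z ∈ F) : G z ⊆ D ∩ q ⁻¹' L := fun w hw => by
      refine ⟨(hGD z hz hw).1, ?_⟩
      have hwV : q w ∈ S ∪ L := hSL ▸ connectedComponentIn_subset (q ⁻¹' V) x (hGD z hz hw).1
      exact hwV.resolve_left fun h => hS h (mem_biUnion hz (mem_image_of_mem q hw))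
    have hbF {w : X} (hw : q w ∈ L) (hbL : b ∈ L) :
        ∃ z ∈ connectedComponentIn (q ⁻¹' L) w, q z = b := by
      rwa [← image_connectedComponentIn_preimage hqc hqo hqcl hL hLc.isPreconnected hw] at hbL
    obtain ⟨z₁, hz₁D, hz₁⟩ : b ∈ q '' D := hD ▸ hbV
    have hz₁F : z₁ ∈ F := ⟨hz₁D, hz₁⟩
    have hbL : b ∈ L := hz₁ ▸ (hGL hz₁F (hG₁ z₁ hz₁F)).2
    refine ⟨⟨z₀, hGL hz₁F (hG₀ z₁ hz₁F)⟩, isPreconnected_of_forall z₀ fun w hw => ?_⟩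
    -- Every component over `L` maps onto `L`, so it contains a point over `b`, from which `G z`
    -- leads to `z₀`.
    obtain ⟨z, hzw, hz⟩ := hbF hw.2 hbL
    have hwD : connectedComponentIn (q ⁻¹' L) w ⊆ D := by
      have : D = connectedComponentIn (q ⁻¹' V) w := connectedComponentIn_eq hw.1
      rw [this]
      exact connectedComponentIn_mono _ (preimage_mono (hSL ▸ subset_union_right))
    have hzF : z ∈ F := ⟨hwD hzw, hz⟩
    refine ⟨connectedComponentIn (q ⁻¹' L) w ∪ G z, union_subset (subset_inter hwD
      (connectedComponentIn_subset _ _)) (hGL hzF), Or.inr (hG₀ z hzF),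
      Or.inl (mem_connectedComponentIn hw.2), ?_⟩
    exact isPreconnected_connectedComponentIn.union z hzw (hG₁ z hzF) (hGc z hzF)

end Neighbourhood

/-! ### The main theorem -/

theorem mainTheorem4 {m n : ℕ} {X : Type u} {Y : Type v} {Xf : Type w}
    [TopologicalSpace X] [T2Space X] [SecondCountableTopology X]
    [ChartedSpace (EuclideanSpace ℝ (Fin m)) X]
    [TopologicalSpace Y] [T2Space Y] [SecondCountableTopology Y]
    [ChartedSpace (EuclideanSpace ℝ (Fin n)) Y]
    [TopologicalSpace Xf] [T2Space Xf] [ConnectedSpace Xf] [LocallyConnectedSpace Xf]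
    (f : X → Y) (hf : IsBranchedCovering f) (hf_proper : HasCompactPreimages f)
    (p : Xf → X) (hp : IsProperCompletedCovering p) (hp_normal : IsNormalBranched p)
    (fbar : Xf → Y) (hfbar : IsProperCompletedCovering fbar) (hfbar_normal : IsNormalBranched fbar)
    (hcomm : fbar = f ∘ p)
    (y : Y) (hy : IsDestructivePoint f y)
    (W : Set Xf) (hW : IsOpen W) (hyW : (fbar ⁻¹' {y} ∩ W).Nonempty) :
    Nontrivial (singularH1 W) := by
  have : LocallyCompactSpace X := ChartedSpace.locallyCompactSpace (EuclideanSpace ℝ (Fin m)) X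
  have : LocallyCompactSpace Y := ChartedSpace.locallyCompactSpace (EuclideanSpace ℝ (Fin n)) Y
  have : LocallyPathConnectedSpace Y :=
    ChartedSpace.locallyPathConnectedSpace (EuclideanSpace ℝ (Fin n)) Y
  have : LocallyConnectedSpace Y := ChartedSpace.locallyConnectedSpace (EuclideanSpace ℝ (Fin n)) Y
  obtain ⟨x, rfl, hxW⟩ := hyW
  have hqc := hfbar.isBranchedCovering.continuous
  have hqo := hfbar.isBranchedCovering.isOpenMap
  have hqcl := hfbar.proper.isClosedMap hqc
  have hpc := hp.isBranchedCovering.continuous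
  have hpo := hp.isBranchedCovering.isOpenMap
  have hpcl := hp.proper.isClosedMap hpc
  have hps : Function.Surjective p := hp_normal.surjective hp.dense_target hpcl
  -- a small destructive neighbourhood `V`, whose component `D` at `x` lies in `W`
  obtain ⟨N, hN, hxN, hNW, hNinj⟩ : ∃ N : Set Xf, IsOpen N ∧ x ∈ N ∧ N ⊆ W ∧
      (fbar x ∈ regularValues fbar → InjOn fbar N) := by
    by_cases hx : fbar x ∈ regularValues fbar
    · obtain ⟨U, hU, hxU, hinj⟩ :=
        (isLocalHomeomorphOn_singleton_iff hqc hqo).1 (mem_regularValues.1 hx x rfl)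
      exact ⟨U ∩ W, hU.inter hW, ⟨hxU, hxW⟩, inter_subset_right,
        fun _ => hinj.mono inter_subset_left⟩
    · exact ⟨W, hW, hxW, subset_rfl, fun h => (hx h).elim⟩
  obtain ⟨U₀, hU₀, hU₀N⟩ := hqcl.exists_nhds_forall_isPreconnected_subset
    (hfbar.proper.finite_fiber hfbar.isBranchedCovering _) hN hxN
  obtain ⟨V, hVU₀, hV⟩ := hy U₀ hU₀
  let D := connectedComponentIn (fbar ⁻¹' V) x
  have hDo : IsOpen D := (hV.domain.1.preimage hqc).connectedComponentIn
  have hDN : D ⊆ N := hU₀N D isPreconnected_connectedComponentIn (mem_connectedComponentIn hV.mem)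
    ((connectedComponentIn_subset _ _).trans (preimage_mono hVU₀))
  obtain ⟨U₁, hU₁, hU₁D⟩ := hfbar.exists_nhds_isConnected_inter hV.domain.1 hV.domain.2 hV.mem
    fun h => (hNinj h).mono hDN
  -- With `S ⊆ K ⊆ V = S ∪ L`, the set `K \ L` is compact, lies in `S` and contains `S \ L`; this is
  -- what Urysohn's lemma needs below.
  obtain ⟨K, hKx, hKV, hK⟩ := local_compact_nhds (hV.domain.1.mem_nhds hV.mem)
  -- the strong domain covering, with `S` the small member
  obtain ⟨S, L, hSL, hS, hL, hSLc, hxS, hSU, hfS, hfSL⟩ : ∃ S L : Set Y, V = S ∪ L ∧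
      IsDomainSet S ∧ IsDomainSet L ∧ IsConnected (S ∩ L) ∧ fbar x ∈ S ∧ S ⊆ U₁ ∩ K ∧
      IsConnected (f ⁻¹' S) ∧ IsNormalBranchedOn f (f ⁻¹' (S ∩ L)) := by
    obtain ⟨A, B, hAB, hsmall, hfAB, hn⟩ := hV.exists_covering (U₁ ∩ K) (Filter.inter_mem hU₁ hKx)
      (inter_subset_right.trans hKV)
    rcases hsmall with ⟨hxA, hAU⟩ | ⟨hxB, hBU⟩
    · exact ⟨A, B, hAB.eq_union, hAB.left, hAB.right, hAB.strong, hxA, hAU, hfAB.left.2, hn⟩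
    · refine ⟨B, A, by rw [union_comm]; exact hAB.eq_union, hAB.right, hAB.left,
        by rw [inter_comm]; exact hAB.strong, hxB, hBU, hfAB.right.2, ?_⟩
      rw [inter_comm]
      exact hn
  have hSV : S ⊆ V := hSL ▸ subset_union_left
  have hSLo : IsOpen (S ∩ L) := hS.1.inter hL.1
  have hLD : IsConnected (D ∩ fbar ⁻¹' L) :=
    hU₁D S L hSL hL.1 hL.2 (hSU.trans inter_subset_left)
  let T := connectedComponentIn (fbar ⁻¹' S) x
  have hTo : IsOpen T := (hS.1.preimage hqc).connectedComponentIn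
  have hTc : IsConnected T := isConnected_connectedComponentIn_iff.2 hxS
  have hTD : T ⊆ D := connectedComponentIn_mono _ (preimage_mono hSV)
  have hTM : IsOpen (T ∩ fbar ⁻¹' (S ∩ L)) := hTo.inter (hSLo.preimage hqc)
  by_cases hcon : IsConnected (T ∩ fbar ⁻¹' (S ∩ L))
  · -- `f` is normal over `S`, hence over all smaller destructive neighbourhoods
    exfalso
    obtain ⟨V', hV'S, hV'⟩ := hy S (hS.1.mem_nhds hxS)
    -- Any covering will do: only the connectedness of `f ⁻¹' V'` is extracted.
    obtain ⟨_, _, -, -, hfV', -⟩ :=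
      hV'.exists_covering V' (hV'.domain.1.mem_nhds hV'.mem) subset_rfl
    have hD' : IsConnected (connectedComponentIn (fbar ⁻¹' V') x) :=
      isConnected_connectedComponentIn_iff.2 hV'.mem
    have hD'o : IsOpen (connectedComponentIn (fbar ⁻¹' V') x) :=
      (hV'.domain.1.preimage hqc).connectedComponentIn
    subst hcomm
    have himage {O : Set Y} (hO : IsOpen O) (hOc : IsConnected (f ⁻¹' O)) (hxO : f (p x) ∈ O) :
        p '' connectedComponentIn (f ∘ p ⁻¹' O) x = f ⁻¹' O :=
      image_connectedComponentIn_preimage hpc hpo hpcl (hO.preimage hf.continuous)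
        hOc.isPreconnected hxO
    have hdense : Dense (f ⁻¹' regularValues (f ∘ p)) := by
      refine (hps.denseRange.dense_image hpc hfbar.dense_source).mono ?_
      rintro _ ⟨z, hz, rfl⟩
      exact hz
    refine hV'.not_normal (isNormalBranchedOn_of_isDeckPair hf hf_proper
      (regularValues_comp_subset hf.continuous hf.isOpenMap hpc hpo hps)
      hfbar.target_notLocallySeparating hdense hV'.domain.1 ?_ fun a b ha hab => ?_)
    · have := (hfbar.isConnected_inter hD'o hD').image p hpc.continuousOn
      rwa [preimage_comp (s := regularValues (f ∘ p)), image_inter_preimage,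
        himage hV'.domain.1 hfV'.domain.2 hV'.mem] at this
    · obtain ⟨τ, τ', h, hτ⟩ := exists_isDeckPair_of_subset hf.continuous hf.isOpenMap hpc hpo hps
        hp_normal hfbar_normal (isOpen_regularValues hqcl) hSLo rfl hTo (himage hS.1 hfS hxS)
        (hfbar.isConnected_inter hTo hTc).isPreconnected (hfbar.isConnected_inter hTM hcon) hfSL
        ⟨hV'S ha.1, ha.2⟩ hab
      exact ⟨τ, τ', h.mono (inter_subset_inter_left _ hV'S), hτ⟩
  · -- two components over `S ∩ L` in one component over `S` produce a loop
    obtain ⟨a₀, ha₀⟩ : (T ∩ fbar ⁻¹' (S ∩ L)).Nonempty := by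
      obtain ⟨s, hs⟩ := hSLc.nonempty
      have hsT : s ∈ fbar '' T := by
        rw [image_connectedComponentIn_preimage hqc hqo hqcl hS.1 hS.2.isPreconnected hxS]
        exact hs.1
      obtain ⟨z, hz, rfl⟩ := hsT
      exact ⟨z, hz, hs⟩
    have hsub {z : Xf} (hz : z ∈ T ∩ fbar ⁻¹' (S ∩ L)) :
        connectedComponentIn (fbar ⁻¹' (S ∩ L)) z ⊆ T ∩ fbar ⁻¹' (S ∩ L) := by
      refine subset_inter ?_ (connectedComponentIn_subset _ _)
      rw [show T = connectedComponentIn (fbar ⁻¹' S) z from connectedComponentIn_eq hz.1]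
      exact connectedComponentIn_mono _ (preimage_mono inter_subset_left)
    obtain ⟨b₀, hb₀, hab₀⟩ : ∃ b₀ ∈ T ∩ fbar ⁻¹' (S ∩ L),
        b₀ ∉ connectedComponentIn (fbar ⁻¹' (S ∩ L)) a₀ := by
      by_contra! h
      refine hcon ?_
      rw [subset_antisymm h (hsub ha₀)]
      exact isConnected_connectedComponentIn_iff.2 ha₀.2
    -- The endpoints are moved within their components to points over regular values, where
    -- connected open sets are path connected.
    have hreg {z : Xf} (hz : z ∈ T ∩ fbar ⁻¹' (S ∩ L)) :
        ∃ w ∈ connectedComponentIn (fbar ⁻¹' (S ∩ L)) z, fbar w ∈ regularValues fbar :=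
      hfbar.dense_source.inter_open_nonempty _ (hSLo.preimage hqc).connectedComponentIn
        ⟨z, mem_connectedComponentIn hz.2⟩
    obtain ⟨a, ha, haR⟩ := hreg ha₀
    obtain ⟨b, hb, hbR⟩ := hreg hb₀
    have hab : b ∉ connectedComponentIn (fbar ⁻¹' (S ∩ L)) a := fun h => by
      rw [← connectedComponentIn_eq ha] at h
      exact hab₀ (connectedComponentIn_eq h ▸ connectedComponentIn_eq hb ▸
        mem_connectedComponentIn hb₀.2)
    have hDW : D ⊆ W := hDN.trans hNW
    obtain ⟨φ, hφ₀, hφ₁, -⟩ := exists_continuous_zero_one_of_isCompact (hK.diff hL.1)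
      hS.1.isClosed_compl (disjoint_left.2 fun z hz hzS => by
        have : z ∈ S ∪ L := hSL ▸ hKV hz.1
        exact this.elim hzS hz.2)
    have haT := hsub ha₀ ha
    have hbT := hsub hb₀ hb
    refine nontrivial_singularH1_of_joinedIn hqc hS.1 hL.1 (1 - φ) (fun z hz => ?_)
      (fun z hzS hzL => ?_) hab
      (((hfbar.isPathConnected_inter hTo hTc).joinedIn a ⟨haT.1, haR⟩ b ⟨hbT.1, hbR⟩).mono
        fun z hz => ⟨hDW (hTD hz.1), connectedComponentIn_subset (fbar ⁻¹' S) x hz.1⟩)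
      (((hfbar.isPathConnected_inter (hDo.inter (hL.1.preimage hqc)) hLD).joinedIn
        b ⟨⟨hTD hbT.1, hbT.2.2⟩, hbR⟩ a ⟨⟨hTD haT.1, haT.2.2⟩, haR⟩).mono
        fun z hz => ⟨hDW hz.1.1, hz.1.2⟩)
    · simp [hφ₁ hz]
    · simp [hφ₀ ⟨(hSU hzS).2, hzL⟩]
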